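/- Call $f:\mathbb N\to\mathbb N$ polynomially bounded if $f(n)\le p(n)$ for all $n$ and some polynomial $p$. A Boolean circuit with $n$ inputs is a finite directed acyclic graph of input, NOT, and unbounded fan-in AND and OR gates with one output gate; its size is the number of gates and its depth is the maximal number of NOT, AND and OR gates on a path ending in the output gate. A (non-uniform) $\mathrm{AC}^0$ family is a sequence $\{C_n\}_{n\in\mathbb N}$ of circuits, $C_n$ with $n$ inputs, of polynomially bounded size and bounded depth. A decoder-only (autoregressive) Transformer with maximal input length $n$ over the alphabet $\{0,1\}$ has hidden dimension $d=H d_k$, $H$ heads and $L$ layers. On tokens $s_1,\dots,s_n$ it computes $\mathbf x_i^0=\mathrm{Embed}(s_i)+\mathrm{pos}(i)\in\mathbb R^d$ and, for $l=1,\dots,L$, $$\mathbf a_i^l=\mathbf x_i^{l-1}+\sum_{h=1}^{H}\Big(\sum_{j\le i}\alpha^{(l,h)}_{ij}\,\mathbf x_j^{l-1}W_v^{(l,h)}\Big)W_o^{(l,h)},\qquad (\alpha^{(l,h)}_{ij})_{j\le i}=\mathrm{softmax}_{j\le i}\Big(\tfrac{(\mathbf x_i^{l-1}W_q^{(l,h)})(\mathbf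 x_j^{l-1}W_k^{(l,h)})^{T}}{\sqrt{d_k}}\Big),$$ $$\mathbf x_i^l=\mathbf a_i^l+\mathrm{GeLU}(\mathbf a_i^lW_1^l+\mathbf b_1^l)W_2^l,$$ where $W_q^{(l,h)},W_k^{(l,h)},W_v^{(l,h)}\in\mathbb R^{d\times d_k}$, $W_o^{(l,h)}\in\mathbb R^{d_k\times d}$, $W_1^l,W_2^l\in\mathbb R^{d\times d}$, $\mathbf b_1^l\in\mathbb R^d$, and $\mathrm{GeLU}(x)=x\Phi(x)$ with $\Phi$ the standard normal distribution function. The next-token probabilities are $\mathrm{softmax}(\mathbf x_n^LW_{\rm out})$ with $W_{\rm out}\in\mathbb R^{d\times 2}$; the Transformer generates a token if that token is the unique most probable one. Its size is its number of parameters. A number format is either fixed-point (a sign, $a$ bits before and $b$ bits after the binary point) or floating-point ($m2^e$ with a signed $a$-bit integer $m$ and a signed $b$-bit integer $e$). A Transformer is run in a number format with a truncation method (round to nearest, towards zero, up, or down, with numbers out of range sent to the nearest representable extreme) if all its parameters are representable in the format and every neuron (embedding; query, key and value entries; attention score; attention weight; head output; summed head outputs; residual sum; pre-activation; GeLU value;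 feed-forward output; logit; next-token probability) is truncated as soon as it is computed. A family $\{T_n\}$ is log-precision if $T_n$ is run in a format with $O(\log n)$ bits. **Statement.** Fix the kind of format (fixed- or floating-point) and one of the four truncation methods. For every non-uniform $\mathrm{AC}^0$ circuit family $\{C_n\}_{n\in\mathbb N}$ there is a family $\{T_n\}_{n\in\mathbb N}$ of log-precision decoder-only Transformers of polynomially bounded size and with a bounded number of layers that simulates $\{C_n\}$: for every $n\ge 1$ and every $x\in\{0,1\}^n$, $T_n$ on the input tokens $x_1,\dots,x_n$ generates the token $C_n(x)$. -/

import Mathlib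

open Asymptotics

/-! ### Growth conditions -/

/-- `f n = poly(n)`. -/
def PolyBounded (f : ℕ → ℕ) : Prop :=
  ∃ p : Polynomial ℕ, ∀ n, f n ≤ p.eval n

/-- `f n = O(log n)`. -/
def LogBounded (f : ℕ → ℕ) : Prop :=
  (fun n => (f n : ℝ)) =O[Filter.atTop] fun n => Real.log (n : ℝ)

/-! ### Boolean circuits with unbounded fan-in -/

/-- The gate at place `g` of a topologically sorted circuit with `n` input bits; it reads only
earlier gates. The empty conjunction is the constant true, the empty disjunction the constant
false. -/
inductive Gate (n g : ℕ) : Type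
  | input (i : Fin n) : Gate n g
  | not (j : Fin g) : Gate n g
  | and (s : Finset (Fin g)) : Gate n g
  | or (s : Finset (Fin g)) : Gate n g

/-- A circuit with `n` input bits and one output bit: a topologically sorted directed acyclic
graph of gates. -/
structure BoolCircuit (n : ℕ) where
  /-- the number of gates -/
  size : ℕ
  gate : (g : Fin size) → Gate n g
  output : Fin size

namespace BoolCircuit

variable {n : ℕ}

/-- The value of gate `g` on the input `x`. -/
def val (C : BoolCircuit n) (x : Fin n → Bool) (g : Fin C.size) : Bool :=
  match C.gate g with
  | .input i => x i
  | .not j => !(C.val x ⟨j, j.isLt.trans g.isLt⟩)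
  | .and s => decide (∀ j ∈ s, C.val x ⟨j, j.isLt.trans g.isLt⟩ = true)
  | .or s => decide (∃ j ∈ s, C.val x ⟨j, j.isLt.trans g.isLt⟩ = true)
termination_by g.val
decreasing_by all_goals exact Fin.isLt _

/-- The number of NOT, AND and OR gates on a longest path ending in gate `g`. -/
def gateDepth (C : BoolCircuit n) (g : Fin C.size) : ℕ :=
  match C.gate g with
  | .input _ => 0
  | .not j => C.gateDepth ⟨j, j.isLt.trans g.isLt⟩ + 1
  | .and s => (s.sup fun j => C.gateDepth ⟨j, j.isLt.trans g.isLt⟩) + 1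
  | .or s => (s.sup fun j => C.gateDepth ⟨j, j.isLt.trans g.isLt⟩) + 1
termination_by g.val
decreasing_by all_goals exact Fin.isLt _

/-- The Boolean function computed by the circuit. -/
def eval (C : BoolCircuit n) (x : Fin n → Bool) : Bool := C.val x C.output

def depth (C : BoolCircuit n) : ℕ := C.gateDepth C.output

end BoolCircuit

/-- A (non-uniform) `AC⁰` circuit family: polynomial size, constant depth, unbounded fan-in. -/
def IsAC0Family (C : (n : ℕ) → BoolCircuit n) : Prop :=
  PolyBounded (fun n => (C n).size) ∧ ∃ D : ℕ, ∀ n, (C n).depth ≤ D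

/-! ### Finite-precision numbers -/

/-- The two ways of storing real numbers. -/
inductive FormatKind : Type
  | fixedPoint
  | floatingPoint

namespace FormatKind

/-- The numbers that can be stored. Fixed-point format: a sign, `a` bits before and `b` bits after
the binary point. Floating-point format: `m * 2 ^ e` with a sign and `a` bits for the integer
mantissa `m`, and a sign and `b` bits for the exponent `e`. -/
def values : FormatKind → ℕ → ℕ → Set ℝ
  | fixedPoint, a, b => {x | ∃ k : ℤ, |k| < 2 ^ (a + b) ∧ x = (k : ℝ) / 2 ^ b}
  | floatingPoint, a, b => {x | ∃ m e : ℤ, |m| < 2 ^ a ∧ |e| < 2 ^ b ∧ x = (m : ℝ) * (2 : ℝ) ^ e}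

/-- The number of bits that a stored number occupies. -/
def bits : FormatKind → ℕ → ℕ → ℕ
  | fixedPoint, a, b => a + b + 1
  | floatingPoint, a, b => (a + 1) + (b + 1)

end FormatKind

/-- The four truncation methods. -/
inductive RoundingMode : Type
  | toNearest
  | towardZero
  | up
  | down

/-- `ρ` truncates every real number to one of the numbers in `F` by the given method. Numbers out
of range are mapped to the extreme element of `F`; ties in round-to-nearest may be broken in any
way. -/
def RoundingMode.IsRounding (r : RoundingMode) (F : Set ℝ) (ρ : ℝ → ℝ) : Prop :=
  ∀ x, ρ x ∈ F ∧
    match r with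
    | .toNearest => ∀ y ∈ F, |ρ x - x| ≤ |y - x|
    | .towardZero => ρ x ∈ Set.uIcc 0 x ∧ ∀ y ∈ F, y ∈ Set.uIcc 0 x → |y| ≤ |ρ x|
    | .up => (x ≤ ρ x ∧ ∀ y ∈ F, x ≤ y → ρ x ≤ y) ∨ (ρ x < x ∧ ∀ y ∈ F, y ≤ ρ x)
    | .down => (ρ x ≤ x ∧ ∀ y ∈ F, y ≤ x → y ≤ ρ x) ∨ (x < ρ x ∧ ∀ y ∈ F, ρ x ≤ y)

/-! ### Decoder-only Transformers -/

/-- The Gaussian error linear unit `x ↦ x Φ(x)`, with `Φ` the standard normal distribution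
function. -/
noncomputable def gelu (x : ℝ) : ℝ :=
  x * ProbabilityTheory.cdf (ProbabilityTheory.gaussianReal 0 1) x

/-- The parameters of one layer with `H` heads of dimension `dk` and hidden dimension
`d = H * dk`. -/
structure TransformerLayer (H dk : ℕ) where
  Wq : Fin H → Matrix (Fin (H * dk)) (Fin dk) ℝ
  Wk : Fin H → Matrix (Fin (H * dk)) (Fin dk) ℝ
  Wv : Fin H → Matrix (Fin (H * dk)) (Fin dk) ℝ
  Wo : Fin H → Matrix (Fin dk) (Fin (H * dk)) ℝ
  W₁ : Matrix (Fin (H * dk)) (Fin (H * dk)) ℝ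
  b₁ : Fin (H * dk) → ℝ
  W₂ : Matrix (Fin (H * dk)) (Fin (H * dk)) ℝ

namespace TransformerLayer

variable {H dk n : ℕ}

/-- All parameters of the layer lie in `F`. -/
def ParamsIn (ℓ : TransformerLayer H dk) (F : Set ℝ) : Prop :=
  (∀ h i c, ℓ.Wq h i c ∈ F) ∧ (∀ h i c, ℓ.Wk h i c ∈ F) ∧ (∀ h i c, ℓ.Wv h i c ∈ F) ∧
  (∀ h c i, ℓ.Wo h c i ∈ F) ∧ (∀ i j, ℓ.W₁ i j ∈ F) ∧ (∀ i, ℓ.b₁ i ∈ F) ∧ (∀ i j, ℓ.W₂ i j ∈ F)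

/-! The forward pass of a layer on a sequence `X` of `n` row vectors. Every neuron is truncated
by `ρ` as soon as it is computed; `ρ = id` is the infinite-precision Transformer. -/

variable (ρ : ℝ → ℝ)

/-- A linear map without bias applied to a row vector, with truncated output. -/
def linear {p q : ℕ} (x : Fin p → ℝ) (W : Matrix (Fin p) (Fin q) ℝ) (c : Fin q) : ℝ :=
  ρ (∑ e, x e * W e c)

variable (ℓ : TransformerLayer H dk) (X : Fin n → Fin (H * dk) → ℝ)

/-- The scaled inner product of the query at position `i` and the key at position `j`. -/
noncomputable def score (h : Fin H) (i j : Fin n) : ℝ :=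
  ρ ((∑ c, linear ρ (X i) (ℓ.Wq h) c * linear ρ (X j) (ℓ.Wk h) c) / √(dk : ℝ))

/-- The causal softmax: position `i` attends to the positions `j ≤ i`. -/
noncomputable def weight (h : Fin H) (i j : Fin n) : ℝ :=
  ρ (Real.exp (ℓ.score ρ X h i j) / ∑ j' ∈ Finset.Iic i, Real.exp (ℓ.score ρ X h i j'))

/-- The output of one attention head. -/
noncomputable def head (h : Fin H) (i : Fin n) (c : Fin dk) : ℝ :=
  ρ (∑ j ∈ Finset.Iic i, ℓ.weight ρ X h i j * linear ρ (X j) (ℓ.Wv h) c)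

/-- Multi-head attention. -/
noncomputable def multiHead (i : Fin n) (e : Fin (H * dk)) : ℝ :=
  ρ (∑ h, ∑ c, ℓ.head ρ X h i c * ℓ.Wo h c e)

/-- Multi-head attention with the residual connection. -/
noncomputable def attention (i : Fin n) (e : Fin (H * dk)) : ℝ :=
  ρ (ℓ.multiHead ρ X i e + X i e)

/-- The feed-forward network `GeLU(x W₁ + b₁) W₂`. -/
noncomputable def ffn (x : Fin (H * dk) → ℝ) : Fin (H * dk) → ℝ :=
  linear ρ (fun e => ρ (gelu (ρ ((∑ e', x e' * ℓ.W₁ e' e) + ℓ.b₁ e)))) ℓ.W₂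

/-- The output of the layer. -/
noncomputable def forward (i : Fin n) (e : Fin (H * dk)) : ℝ :=
  ρ (ℓ.attention ρ X i e + ℓ.ffn ρ (ℓ.attention ρ X i) e)

end TransformerLayer

/-- A decoder-only Transformer over the token alphabet `{0, 1}` with maximal input length `n`. -/
structure Transformer (n : ℕ) where
  /-- the number `H` of attention heads per layer -/
  heads : ℕ
  /-- the dimension `d_k` of a head; the hidden dimension is `d = H * d_k` -/
  headDim : ℕ
  /-- the number `L` of layers -/
  numLayers : ℕ
  embed : Bool → Fin (heads * headDim) → ℝ
  pos : Fin n → Fin (heads * headDim) → ℝ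
  layer : Fin numLayers → TransformerLayer heads headDim
  /-- the output layer, from the hidden dimension to the token alphabet -/
  unembed : Fin (heads * headDim) → Bool → ℝ

namespace Transformer

variable {n : ℕ}

/-- The hidden dimension. -/
def dim (T : Transformer n) : ℕ := T.heads * T.headDim

/-- The number of parameters: embedding, position embedding, layers
(`Wq, Wk, Wv, Wo` per head, and `W₁, W₂, b₁`), output layer. -/
def size (T : Transformer n) : ℕ :=
  2 * T.dim + n * T.dim +
    T.numLayers * (T.heads * (4 * (T.dim * T.headDim)) + 2 * T.dim ^ 2 + T.dim) + 2 * T.dim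

/-- All parameters of the Transformer lie in `F`. -/
def ParamsIn (T : Transformer n) (F : Set ℝ) : Prop :=
  (∀ t e, T.embed t e ∈ F) ∧ (∀ i e, T.pos i e ∈ F) ∧ (∀ l, (T.layer l).ParamsIn F) ∧
  (∀ e t, T.unembed e t ∈ F)

/-- The hidden states after the first `l` layers on the token sequence `s`. -/
noncomputable def hidden (T : Transformer n) (ρ : ℝ → ℝ) (s : Fin n → Bool) :
    (l : ℕ) → l ≤ T.numLayers → Fin n → Fin (T.heads * T.headDim) → ℝ
  | 0, _ => fun i e => ρ (T.embed (s i) e + T.pos i e)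
  | l + 1, h => (T.layer ⟨l, h⟩).forward ρ (T.hidden ρ s l (Nat.le_of_succ_le h))

noncomputable def logit (T : Transformer n) (ρ : ℝ → ℝ) (s : Fin n → Bool) (i : Fin n)
    (t : Bool) : ℝ :=
  ρ (∑ e, T.hidden ρ s T.numLayers le_rfl i e * T.unembed e t)

/-- The probability, by the final softmax at position `i`, that the next token is `t`. -/
noncomputable def nextProb (T : Transformer n) (ρ : ℝ → ℝ) (s : Fin n → Bool) (i : Fin n)
    (t : Bool) : ℝ :=
  ρ (Real.exp (T.logit ρ s i t) / ∑ t', Real.exp (T.logit ρ s i t'))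

/-- Having read all of `s`, the Transformer generates the token `t`: at the last position `t` is
the unique most probable next token. -/
def Generates (T : Transformer n) (ρ : ℝ → ℝ) (s : Fin n → Bool) (t : Bool) : Prop :=
  ∀ i : Fin n, i.val + 1 = n → ∀ t', t' ≠ t → T.nextProb ρ s i t' < T.nextProb ρ s i t

end Transformer

/-!
Let `M` be the largest number of the format; false is represented by `0` and true by `M`. A
truncated sum of such values saturates at `M` as soon as one summand is `M`, so it is exactly a
disjunction of unbounded fan-in, whatever the truncation method.

The first layer attends uniformly, which brings all input bits to the last position: with
`n ≤ 2 ^ q ≤ M` every attention weight is at least `2 ^ (-q)`, so a true bit contributes at least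
`1`, and multiplication by `M` saturates again. Layer `l + 1` evaluates the gates of depth `l` by
De Morgan's law: the pre-activation is a disjunction of literals, GeLU fixes `0` and keeps `M` at
least `1`, and multiplication by `± M` restores the truth value. A complement is taken by
subtraction from the GeLU value of a constant coordinate, where the truncation errors cancel.
-/

/-! ### Truncation -/

/-- `ρ` sends every real number to an element of `F` and never jumps over an element of `F`: what
the four truncation methods have in common, and all that the simulation uses of them. -/
structure IsTruncation (F : Set ℝ) (ρ : ℝ → ℝ) : Prop where
  mem : ∀ x, ρ x ∈ F
  le_of_le : ∀ {x y}, y ∈ F → x ≤ y → ρ x ≤ y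
  le_of_ge : ∀ {x y}, y ∈ F → y ≤ x → y ≤ ρ x

namespace RoundingMode.IsRounding

variable {r : RoundingMode} {F : Set ℝ} {ρ : ℝ → ℝ} {x y : ℝ}

theorem le_of_le (h : r.IsRounding F ρ) (hy : y ∈ F) (hxy : x ≤ y) : ρ x ≤ y := by
  have hx := (h x).2
  cases r with
  | toNearest => grind
  | towardZero => grind [Set.mem_uIcc]
  | up => exact hx.elim (fun h => h.2 y hy hxy) (fun h => h.1.le.trans hxy)
  | down => exact hx.elim (fun h => h.1.trans hxy) (fun h => h.2 y hy)

theorem le_of_ge (h : r.IsRounding F ρ) (hy : y ∈ F) (hyx : y ≤ x) : y ≤ ρ x := by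
  have hx := (h x).2
  cases r with
  | toNearest => grind
  | towardZero => grind [Set.mem_uIcc]
  | up => exact hx.elim (fun h => hyx.trans h.1) (fun h => h.2 y hy)
  | down => exact hx.elim (fun h => h.2 y hy hyx) (fun h => hyx.trans h.1.le)

theorem isTruncation (h : r.IsRounding F ρ) : IsTruncation F ρ :=
  ⟨fun x => (h x).1, h.le_of_le, h.le_of_ge⟩

end RoundingMode.IsRounding

namespace IsTruncation

variable {F : Set ℝ} {ρ : ℝ → ℝ} {M x : ℝ}

theorem eq_self (hρ : IsTruncation F ρ) (hx : x ∈ F) : ρ x = x :=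
  le_antisymm (hρ.le_of_le hx le_rfl) (hρ.le_of_ge hx le_rfl)

theorem eq_greatest (hρ : IsTruncation F ρ) (hM : IsGreatest F M) (hx : M ≤ x) : ρ x = M :=
  le_antisymm (hM.2 (hρ.mem x)) (hρ.le_of_ge hM.1 hx)

theorem mul_greatest_eq_greatest (hρ : IsTruncation F ρ) (hM : IsGreatest F M) (h0 : 0 ∈ F)
    (h1 : 1 ∈ F) (hx : 1 ≤ x) : ρ (ρ x * M) = M :=
  hρ.eq_greatest hM (le_mul_of_one_le_left (hM.2 h0) (hρ.le_of_ge h1 hx))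

end IsTruncation

/-! ### Number formats -/

namespace FormatKind

variable (κ : FormatKind) {a b : ℕ}

theorem finite_values (a b : ℕ) : (κ.values a b).Finite := by
  cases κ with
  | fixedPoint =>
    refine ((Set.finite_Ioo (-2 ^ (a + b) : ℤ) (2 ^ (a + b))).image
      fun k : ℤ => (k : ℝ) / 2 ^ b).subset ?_
    rintro _ ⟨k, hk, rfl⟩
    exact ⟨k, abs_lt.1 hk, rfl⟩
  | floatingPoint =>
    refine (((Set.finite_Ioo (-2 ^ a : ℤ) (2 ^ a)).prod
      (Set.finite_Ioo (-2 ^ b : ℤ) (2 ^ b))).image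
      fun p : ℤ × ℤ => (p.1 : ℝ) * (2 : ℝ) ^ p.2).subset ?_
    rintro _ ⟨m, e, hm, he, rfl⟩
    exact ⟨(m, e), ⟨abs_lt.1 hm, abs_lt.1 he⟩, rfl⟩

theorem neg_mem_values {x : ℝ} (hx : x ∈ κ.values a b) : -x ∈ κ.values a b := by
  cases κ with
  | fixedPoint =>
    obtain ⟨k, hk, rfl⟩ := hx
    exact ⟨-k, by rwa [abs_neg], by push_cast; ring⟩
  | floatingPoint =>
    obtain ⟨m, e, hm, he, rfl⟩ := hx
    exact ⟨-m, e, by rwa [abs_neg], he, by push_cast; ring⟩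

theorem natCast_mem_values {k : ℕ} (hk : k < 2 ^ a) : (k : ℝ) ∈ κ.values a b := by
  cases κ with
  | fixedPoint =>
    refine ⟨((k * 2 ^ b : ℕ) : ℤ), ?_, ?_⟩
    · rw [Nat.abs_cast, pow_add]
      exact_mod_cast Nat.mul_lt_mul_of_pos_right hk (by positivity)
    · push_cast
      rw [mul_div_cancel_right₀ _ (by positivity)]
  | floatingPoint =>
    exact ⟨k, 0, by rw [Nat.abs_cast]; exact_mod_cast hk, by simp, by simp⟩

theorem inv_two_pow_mem_values (ha : 0 < a) {j : ℕ} (hj : j ≤ b) :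
    ((2 : ℝ) ^ j)⁻¹ ∈ κ.values a b := by
  cases κ with
  | fixedPoint =>
    refine ⟨2 ^ (b - j), ?_, ?_⟩
    · rw [abs_of_pos (by positivity)]
      exact pow_lt_pow_right₀ one_lt_two (by lia)
    · rw [eq_div_iff (by positivity), Int.cast_pow, Int.cast_ofNat, inv_mul_eq_iff_eq_mul₀
        (by positivity), ← pow_add, Nat.add_sub_cancel' hj]
  | floatingPoint =>
    refine ⟨1, -j, ?_, ?_, by simp⟩
    · simpa using one_lt_pow₀ (one_lt_two (α := ℤ)) ha.ne'
    · rw [abs_neg, Nat.abs_cast]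
      exact_mod_cast hj.trans_lt Nat.lt_two_pow_self

theorem exists_isGreatest_values (a b : ℕ) : ∃ M, IsGreatest (κ.values a b) M := by
  obtain ⟨M, hM, hmax⟩ := Set.exists_max_image (κ.values a b) id (κ.finite_values a b)
    ⟨((0 : ℕ) : ℝ), κ.natCast_mem_values (by positivity)⟩
  exact ⟨M, hM, hmax⟩

theorem bits_le (a b : ℕ) : κ.bits a b ≤ a + b + 2 := by
  cases κ <;> simp only [bits] <;> lia

end FormatKind

/-- `F` is a set of numbers with greatest element `M` in which the simulation can be run when
`2 ^ q` bounds the input length and the number of gates. -/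
structure HasPrecision (F : Set ℝ) (q : ℕ) (M : ℝ) : Prop where
  isGreatest : IsGreatest F M
  neg_mem : ∀ {x}, x ∈ F → -x ∈ F
  natCast_mem : ∀ {k : ℕ}, k ≤ 2 ^ q → (k : ℝ) ∈ F
  inv_two_pow_mem : ∀ {j}, j ≤ q → ((2 : ℝ) ^ j)⁻¹ ∈ F

theorem FormatKind.exists_hasPrecision (κ : FormatKind) (q : ℕ) :
    ∃ M, HasPrecision (κ.values (q + 1) (q + 1)) q M := by
  obtain ⟨M, hM⟩ := κ.exists_isGreatest_values (q + 1) (q + 1)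
  exact ⟨M, hM, κ.neg_mem_values,
    fun hk => κ.natCast_mem_values (hk.trans_lt (Nat.pow_lt_pow_succ one_lt_two)),
    fun hj => κ.inv_two_pow_mem_values q.succ_pos (Nat.le_succ_of_le hj)⟩

namespace HasPrecision

variable {F : Set ℝ} {q : ℕ} {M : ℝ}

theorem zero_mem (hF : HasPrecision F q M) : (0 : ℝ) ∈ F := by
  exact_mod_cast hF.natCast_mem (Nat.zero_le _)

theorem one_mem (hF : HasPrecision F q M) : (1 : ℝ) ∈ F := by
  exact_mod_cast hF.natCast_mem Nat.one_le_two_pow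

theorem two_pow_le (hF : HasPrecision F q M) : 2 ^ q ≤ M := by
  exact_mod_cast hF.isGreatest.2 (hF.natCast_mem le_rfl)

theorem one_le_truncation_mul {ρ : ℝ → ℝ} (hF : HasPrecision F q M) (hρ : IsTruncation F ρ)
    {k : ℕ} (hk : k + 1 ≤ 2 ^ q) : 1 ≤ ρ (1 / (k + 1 : ℝ)) * M := by
  have hweight : ((2 : ℝ) ^ q)⁻¹ ≤ ρ (1 / (k + 1 : ℝ)) := by
    refine hρ.le_of_ge (hF.inv_two_pow_mem le_rfl) ?_
    rw [one_div]
    gcongr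
    exact_mod_cast hk
  calc (1 : ℝ) = ((2 : ℝ) ^ q)⁻¹ * 2 ^ q := (inv_mul_cancel₀ (by positivity)).symm
    _ ≤ ρ (1 / (k + 1 : ℝ)) * M := by
      have : (0 : ℝ) ≤ ((2 : ℝ) ^ q)⁻¹ := by positivity
      exact mul_le_mul hweight hF.two_pow_le (by positivity) (this.trans hweight)

end HasPrecision

/-! ### The activation function -/

theorem gelu_zero : gelu 0 = 0 := zero_mul _

open MeasureTheory ProbabilityTheory in
theorem half_le_cdf_gaussianReal {x : ℝ} (hx : 0 ≤ x) : 1 / 2 ≤ cdf (gaussianReal 0 1) x := by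
  set μ := gaussianReal 0 1
  have hsymm : μ.real (Set.Ici 0) = μ.real (Set.Iic 0) := by
    have hneg : μ.map (fun x => -x) = μ := by rw [gaussianReal_map_neg, neg_zero]
    rw [← hneg, map_measureReal_apply measurable_neg measurableSet_Ici, hneg]
    simp [Set.Iic, Set.Ici]
  have hcover : 1 ≤ μ.real (Set.Iic 0) + μ.real (Set.Ici 0) := by
    rw [← probReal_univ (μ := μ), ← Set.Iic_union_Ici (a := (0 : ℝ))]
    exact measureReal_union_le _ _
  calc 1 / 2 ≤ cdf μ 0 := by rw [cdf_eq_real]; linarith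
    _ ≤ cdf μ x := monotone_cdf μ hx

theorem half_le_gelu {x : ℝ} (hx : 0 ≤ x) : x / 2 ≤ gelu x := by
  rw [gelu, div_eq_mul_one_div]
  exact mul_le_mul_of_nonneg_left (half_le_cdf_gaussianReal hx) hx

/-! ### Polynomial and logarithmic growth -/

namespace PolyBounded

variable {f g : ℕ → ℕ}

theorem const (c : ℕ) : PolyBounded fun _ => c := ⟨Polynomial.C c, fun n => by simp⟩

protected theorem id : PolyBounded fun n => n := ⟨Polynomial.X, fun n => by simp⟩

protected theorem add (hf : PolyBounded f) (hg : PolyBounded g) :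
    PolyBounded fun n => f n + g n := by
  obtain ⟨p, hp⟩ := hf
  obtain ⟨p', hp'⟩ := hg
  exact ⟨p + p', fun n => by simpa using add_le_add (hp n) (hp' n)⟩

protected theorem mul (hf : PolyBounded f) (hg : PolyBounded g) :
    PolyBounded fun n => f n * g n := by
  obtain ⟨p, hp⟩ := hf
  obtain ⟨p', hp'⟩ := hg
  exact ⟨p * p', fun n => by simpa using Nat.mul_le_mul (hp n) (hp' n)⟩

theorem exists_le_pow (hf : PolyBounded f) : ∃ k, ∀ n, 2 ≤ n → f n ≤ n ^ k := by
  obtain ⟨p, hp⟩ := hf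
  refine ⟨p.eval 1 + p.natDegree, fun n hn => (hp n).trans ?_⟩
  calc p.eval n = ∑ i ∈ Finset.range (p.natDegree + 1), p.coeff i * n ^ i :=
        Polynomial.eval_eq_sum_range n
    _ ≤ ∑ i ∈ Finset.range (p.natDegree + 1), p.coeff i * n ^ p.natDegree := by
        gcongr with i hi
        · lia
        · exact Finset.mem_range_succ_iff.1 hi
    _ = p.eval 1 * n ^ p.natDegree := by
        rw [← Finset.sum_mul, Polynomial.eval_eq_sum_range]
        simp only [one_pow, mul_one]
    _ ≤ n ^ p.eval 1 * n ^ p.natDegree := by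
        gcongr
        exact (Nat.lt_pow_self hn).le
    _ = n ^ (p.eval 1 + p.natDegree) := (pow_add ..).symm

theorem logBounded_log (hf : PolyBounded f) : LogBounded fun n => Nat.log 2 (f n) := by
  obtain ⟨k, hk⟩ := hf.exists_le_pow
  refine IsBigO.of_bound (k / Real.log 2) ?_
  filter_upwards [Filter.eventually_ge_atTop 2] with n hn
  rw [Real.norm_natCast, Real.norm_of_nonneg (Real.log_natCast_nonneg n)]
  calc (Nat.log 2 (f n) : ℝ) ≤ Nat.log 2 (n ^ k) := mod_cast Nat.log_mono_right (hk n hn)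
    _ ≤ Real.logb 2 ((n ^ k : ℕ) : ℝ) := mod_cast Real.natLog_le_logb (n ^ k) 2
    _ = k / Real.log 2 * Real.log n := by rw [Nat.cast_pow, Real.logb_pow, Real.logb]; ring

end PolyBounded

namespace LogBounded

variable {f g : ℕ → ℕ}

protected theorem const (c : ℕ) : LogBounded fun _ => c :=
  (Real.isLittleO_const_log_atTop.comp_tendsto tendsto_natCast_atTop_atTop).isBigO

protected theorem add (hf : LogBounded f) (hg : LogBounded g) : LogBounded fun n => f n + g n := by
  simpa only [LogBounded, Nat.cast_add] using IsBigO.add hf hg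

theorem mono (hg : LogBounded g) (hfg : ∀ n, f n ≤ g n) : LogBounded f :=
  IsBigO.trans (isBigO_of_le _ fun n => by simpa using hfg n) hg

end LogBounded

/-! ### Truth values -/

/-- The real number that represents the truth value `v` in a format with greatest element `M`. -/
def truthValue (M : ℝ) (v : Bool) : ℝ := if v then M else 0

section TruthValue

variable {F : Set ℝ} {ρ : ℝ → ℝ} {M : ℝ} {ι : Type*} {t : Finset ι} {v : ι → Bool}

theorem truthValue_true : truthValue M true = M := rfl

theorem truthValue_false : truthValue M false = 0 := rfl

theorem truthValue_not (v : Bool) : truthValue M (!v) = M - truthValue M v := by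
  cases v <;> simp [truthValue]

theorem truthValue_mem (hM : M ∈ F) (h0 : 0 ∈ F) (v : Bool) : truthValue M v ∈ F := by
  cases v
  exacts [h0, hM]

theorem truthValue_nonneg (hM : 0 ≤ M) (v : Bool) : 0 ≤ truthValue M v := by
  cases v
  exacts [le_rfl, hM]

theorem sum_truthValue_eq_zero (h : ¬∃ j ∈ t, v j = true) : ∑ j ∈ t, truthValue M (v j) = 0 :=
  Finset.sum_eq_zero fun j hj => if_neg fun hv => h ⟨j, hj, hv⟩

theorem le_sum_truthValue (hM : 0 ≤ M) (h : ∃ j ∈ t, v j = true) :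
    M ≤ ∑ j ∈ t, truthValue M (v j) := by
  obtain ⟨j, hj, hv⟩ := h
  calc M = truthValue M (v j) := (if_pos hv).symm
    _ ≤ ∑ j ∈ t, truthValue M (v j) :=
      Finset.single_le_sum (fun j _ => truthValue_nonneg hM (v j)) hj

namespace IsTruncation

theorem sum_truthValue (hρ : IsTruncation F ρ) (hM : IsGreatest F M) (h0 : 0 ∈ F)
    [Decidable (∃ j ∈ t, v j = true)] :
    ρ (∑ j ∈ t, truthValue M (v j)) = truthValue M (decide (∃ j ∈ t, v j = true)) := by
  by_cases h : ∃ j ∈ t, v j = true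
  · rw [decide_eq_true h, truthValue_true, hρ.eq_greatest hM (le_sum_truthValue (hM.2 h0) h)]
  · rw [decide_eq_false h, truthValue_false, sum_truthValue_eq_zero h, hρ.eq_self h0]

theorem truthValue_add (hρ : IsTruncation F ρ) (hM : IsGreatest F M) (h0 : 0 ∈ F) (u v : Bool) :
    ρ (truthValue M u + truthValue M v) = truthValue M (u || v) := by
  have h := hρ.sum_truthValue hM h0 (t := Finset.univ) (v := fun b => cond b u v)
  simpa [Bool.or_comm] using h

theorem mul_sum_truthValue_mul (hρ : IsTruncation F ρ) (hM : IsGreatest F M) (h0 : 0 ∈ F)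
    (h1 : 1 ∈ F) {w : ℝ} (hw : 0 ≤ w) (hwM : 1 ≤ w * M) [Decidable (∃ j ∈ t, v j = true)] :
    ρ (ρ (w * ∑ j ∈ t, truthValue M (v j)) * M) =
      truthValue M (decide (∃ j ∈ t, v j = true)) := by
  by_cases h : ∃ j ∈ t, v j = true
  · have hsum : 1 ≤ w * ∑ j ∈ t, truthValue M (v j) :=
      hwM.trans (mul_le_mul_of_nonneg_left (le_sum_truthValue (hM.2 h0) h) hw)
    rw [decide_eq_true h, truthValue_true, hρ.mul_greatest_eq_greatest hM h0 h1 hsum]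
  · rw [decide_eq_false h, truthValue_false, sum_truthValue_eq_zero h, mul_zero, hρ.eq_self h0,
      zero_mul, hρ.eq_self h0]

/-- The truncation error in `ρ (gelu M)` cancels exactly in the complemented case. -/
theorem gelu_truthValue_xor (hρ : IsTruncation F ρ) (hM : IsGreatest F M) (h0 : 0 ∈ F)
    (h1 : 1 ∈ F) (h2 : 2 ≤ M) (u v : Bool) :
    ρ (ρ (gelu M) * truthValue M u + ρ (gelu (truthValue M v)) * (if u then -M else M)) =
      truthValue M (u ^^ v) := by
  have hgelu : 1 ≤ gelu M := by linarith [half_le_gelu (hM.2 h0)]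
  have hamp : ρ (ρ (gelu M) * M) = M := hρ.mul_greatest_eq_greatest hM h0 h1 hgelu
  cases u <;> cases v <;> simp [truthValue, gelu_zero, hρ.eq_self h0, hamp]

end IsTruncation

end TruthValue

/-! ### Layers with a single head -/

namespace TransformerLayer

section General

variable {ρ : ℝ → ℝ} {H dk n : ℕ} (ℓ : TransformerLayer H dk) (X : Fin n → Fin (H * dk) → ℝ)

theorem linear_zero (h0 : ρ 0 = 0) {p q : ℕ} (x : Fin p → ℝ) (c : Fin q) :
    linear ρ x 0 c = 0 := by
  simp [linear, h0]

theorem linear_submatrix {ι ι' : Type*} [Fintype ι] {p q : ℕ} (e : ι ≃ Fin p) (e' : ι' ≃ Fin q)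
    (A : Matrix ι ι' ℝ) (x : Fin p → ℝ) (c : ι') :
    linear ρ x (A.submatrix e.symm e'.symm) (e' c) = ρ (∑ m, x (e m) * A m c) := by
  simp only [linear, Matrix.submatrix_apply, Equiv.symm_apply_apply, ← e.sum_comp]

theorem weight_of_Wq_eq_zero (h0 : ρ 0 = 0) {h : Fin H} (hq : ℓ.Wq h = 0) (i j : Fin n) :
    ℓ.weight ρ X h i j = ρ (1 / (i + 1 : ℝ)) := by
  simp [weight, score, hq, linear_zero h0, h0]

theorem attention_of_Wo_eq_zero (h0 : ρ 0 = 0) (ho : ∀ h, ℓ.Wo h = 0) (i : Fin n)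
    (e : Fin (H * dk)) : ℓ.attention ρ X i e = ρ (X i e) := by
  simp [attention, multiHead, ho, h0]

theorem forward_of_W₂_eq_zero (h0 : ρ 0 = 0) (h2 : ℓ.W₂ = 0) (i : Fin n) (e : Fin (H * dk)) :
    ℓ.forward ρ X i e = ρ (ℓ.attention ρ X i e) := by
  rw [forward, ffn, h2, linear_zero h0, add_zero]

end General

variable {ι : Type*} {d : ℕ} (e : ι ≃ Fin d)

/-- The indexing of the hidden dimension `1 * d` of a layer with one head that corresponds to the
indexing `e` of the head dimension `d`. -/
def hiddenIndex : ι ≃ Fin (1 * d) := e.trans (finCongr (one_mul d).symm)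

/-- The layer that applies `V`, averages over all positions up to the current one and applies `O`,
without feed-forward network. The rows and columns are indexed by `ι`. -/
def uniformAttention (V O : Matrix ι ι ℝ) : TransformerLayer 1 d where
  Wq _ := 0
  Wk _ := 0
  Wv _ := V.submatrix (hiddenIndex e).symm e.symm
  Wo _ := O.submatrix e.symm (hiddenIndex e).symm
  W₁ := 0
  b₁ := 0
  W₂ := 0

/-- The layer that consists of the feed-forward network with matrices `A` and `B` only. The rows
and columns are indexed by `ι`. -/
def feedForward (A B : Matrix ι ι ℝ) : TransformerLayer 1 d where
  Wq _ := 0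
  Wk _ := 0
  Wv _ := 0
  Wo _ := 0
  W₁ := A.submatrix (hiddenIndex e).symm (hiddenIndex e).symm
  b₁ := 0
  W₂ := B.submatrix (hiddenIndex e).symm (hiddenIndex e).symm

theorem uniformAttention_paramsIn {F : Set ℝ} (h0 : 0 ∈ F) {V O : Matrix ι ι ℝ}
    (hV : ∀ k c, V k c ∈ F) (hO : ∀ k c, O k c ∈ F) : (uniformAttention e V O).ParamsIn F :=
  ⟨fun _ _ _ => h0, fun _ _ _ => h0, fun _ _ _ => hV _ _, fun _ _ _ => hO _ _,
    fun _ _ => h0, fun _ => h0, fun _ _ => h0⟩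

theorem feedForward_paramsIn {F : Set ℝ} (h0 : 0 ∈ F) {A B : Matrix ι ι ℝ}
    (hA : ∀ k c, A k c ∈ F) (hB : ∀ k c, B k c ∈ F) : (feedForward e A B).ParamsIn F :=
  ⟨fun _ _ _ => h0, fun _ _ _ => h0, fun _ _ _ => h0, fun _ _ _ => h0,
    fun _ _ => hA _ _, fun _ => h0, fun _ _ => hB _ _⟩

variable [Fintype ι] {ρ : ℝ → ℝ} {n : ℕ} (X : Fin n → Fin (1 * d) → ℝ)

theorem uniformAttention_head (h0 : ρ 0 = 0) (V O : Matrix ι ι ℝ) (h : Fin 1) (i : Fin n)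
    (k : ι) :
    (uniformAttention e V O).head ρ X h i (e k) =
      ρ (ρ (1 / (i + 1 : ℝ)) *
        ∑ j ∈ Finset.Iic i, ρ (∑ m, X j (hiddenIndex e m) * V m k)) := by
  simp only [head, weight_of_Wq_eq_zero (uniformAttention e V O) X h0 rfl, ← Finset.mul_sum]
  simp only [uniformAttention, linear_submatrix]

theorem uniformAttention_forward (h0 : ρ 0 = 0) (V O : Matrix ι ι ℝ) (i : Fin n) (c : ι) :
    (uniformAttention e V O).forward ρ X i (hiddenIndex e c) =
      ρ (ρ (ρ (∑ k, (uniformAttention e V O).head ρ X 0 i (e k) * O k c) +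
        X i (hiddenIndex e c))) := by
  rw [forward_of_W₂_eq_zero _ _ h0 rfl, attention, multiHead, Fin.sum_univ_one]
  simp only [← e.sum_comp]
  simp only [uniformAttention, Matrix.submatrix_apply, Equiv.symm_apply_apply]

theorem feedForward_ffn (A B : Matrix ι ι ℝ) (x : Fin (1 * d) → ℝ) (c : ι) :
    (feedForward e A B).ffn ρ x (hiddenIndex e c) =
      ρ (∑ k, ρ (gelu (ρ (∑ m, x (hiddenIndex e m) * A m k))) * B k c) := by
  simp only [ffn, feedForward, linear_submatrix, Matrix.submatrix_apply, Pi.zero_apply, add_zero,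
    Equiv.symm_apply_apply, ← (hiddenIndex e).sum_comp]

theorem feedForward_forward (h0 : ρ 0 = 0) (A B : Matrix ι ι ℝ) (i : Fin n)
    (hX : ∀ m, ρ (X i m) = X i m) (c : ι) :
    (feedForward e A B).forward ρ X i (hiddenIndex e c) =
      ρ (X i (hiddenIndex e c) +
        ρ (∑ k, ρ (gelu (ρ (∑ m, X i (hiddenIndex e m) * A m k))) * B k c)) := by
  have hattention : (feedForward e A B).attention ρ X i = X i := by
    funext m
    rw [attention_of_Wo_eq_zero _ _ h0 (fun _ => rfl), hX]
  rw [forward, hattention, feedForward_ffn]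

end TransformerLayer

theorem Transformer.hidden_mem {n : ℕ} {F : Set ℝ} {ρ : ℝ → ℝ} (hρ : ∀ x, ρ x ∈ F)
    (T : Transformer n) (s : Fin n → Bool) {l : ℕ} (hl : l ≤ T.numLayers) (i : Fin n)
    (e : Fin (T.heads * T.headDim)) : T.hidden ρ s l hl i e ∈ F := by
  cases l <;> exact hρ _

/-! ### Gates as disjunctions of literals -/

namespace Gate

variable {n g : ℕ}

/-- The earlier gates that a gate reads. -/
def fanin : Gate n g → Finset (Fin g)
  | input _ => ∅
  | not j => {j}
  | and s => s
  | or s => s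

/-- Whether the disjunction by which a gate is computed runs over the negations of the gates
read; the other part of De Morgan's law is `negatesOutput`. -/
def negatesFanin : Gate n g → Bool
  | and _ => true
  | _ => false

/-- Whether a gate is computed as the negation of a disjunction. -/
def negatesOutput : Gate n g → Bool
  | not _ => true
  | and _ => true
  | _ => false

/-- Whether a gate is the input gate for the bit `i`. -/
def readsInput : Gate n g → Fin n → Bool
  | input k, i => decide (k = i)
  | _, _ => false

end Gate

namespace BoolCircuit

section Evaluation

variable {n : ℕ} (C : BoolCircuit n) {x : Fin n → Bool} {g : Fin C.size}

/-- The gates that gate `g` reads, as gates of the whole circuit. -/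
def fanin (g : Fin C.size) : Finset (Fin C.size) :=
  (C.gate g).fanin.map (Fin.castLEEmb g.isLt.le)

theorem gateDepth_lt_of_mem_fanin {j : Fin C.size} (h : j ∈ C.fanin g) :
    C.gateDepth j < C.gateDepth g := by
  obtain ⟨k, hk, rfl⟩ := Finset.mem_map.1 h
  have hle (s : Finset (Fin g)) (hs : k ∈ s) :
      C.gateDepth (Fin.castLEEmb g.isLt.le k) ≤
        s.sup fun j => C.gateDepth ⟨j, j.isLt.trans g.isLt⟩ :=
    Finset.le_sup (f := fun j : Fin g => C.gateDepth ⟨j, j.isLt.trans g.isLt⟩) hs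
  rw [gateDepth.eq_def C g]
  cases hg : C.gate g with
  | input i => simp [hg, Gate.fanin] at hk
  | not k' =>
    obtain rfl : k = k' := by simpa [hg, Gate.fanin] using hk
    exact Nat.lt_succ_self _
  | and s => exact Nat.lt_succ_of_le (hle s (by simpa [hg, Gate.fanin] using hk))
  | or s => exact Nat.lt_succ_of_le (hle s (by simpa [hg, Gate.fanin] using hk))

theorem val_eq_negatesOutput_xor (hg : C.gateDepth g ≠ 0) :
    C.val x g = ((C.gate g).negatesOutput ^^
      decide (∃ j ∈ C.fanin g, (C.val x j ^^ (C.gate g).negatesFanin) = true)) := by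
  rw [gateDepth] at hg
  rw [val.eq_def C x g, fanin]
  cases h : C.gate g with
  | input i => simp [h] at hg
  | not k => simp [Gate.fanin, Gate.negatesFanin, Gate.negatesOutput, Fin.castLE]
  | and s => simp [Gate.fanin, Gate.negatesFanin, Gate.negatesOutput, Fin.castLE, ← decide_not]
  | or s => simp [Gate.fanin, Gate.negatesFanin, Gate.negatesOutput, Fin.castLE]

/-- The value of gate `g`, or false if the depth of `g` exceeds `l`: what the simulation knows of
`g` when it has evaluated the circuit up to depth `l`. -/
def valUpTo (l : ℕ) (x : Fin n → Bool) (g : Fin C.size) : Bool :=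
  decide (C.gateDepth g ≤ l) && C.val x g

theorem valUpTo_of_le {l : ℕ} (hg : C.gateDepth g ≤ l) : C.valUpTo l x g = C.val x g := by
  rw [valUpTo, decide_eq_true hg, Bool.true_and]

theorem valUpTo_zero :
    C.valUpTo 0 x g = decide (∃ i, ((C.gate g).readsInput i && x i) = true) := by
  rw [valUpTo, gateDepth, val]
  cases C.gate g <;> simp [Gate.readsInput]

theorem valUpTo_succ (l : ℕ) :
    C.valUpTo (l + 1) x g =
      (C.valUpTo l x g || (decide (C.gateDepth g = l + 1) && C.val x g)) := by
  simp only [valUpTo, ← Bool.and_or_distrib_right, ← Bool.decide_or, Nat.le_succ_iff]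

end Evaluation

end BoolCircuit

/-! ### The simulation -/

/-- The coordinates of the hidden states that simulate a circuit with `S` gates: a constant, and
for every gate one coordinate `src` through which its input bit enters and one coordinate `gate`
that receives its value. -/
inductive Coord (S : ℕ) : Type
  | const
  | src (g : Fin S)
  | gate (g : Fin S)

namespace Coord

variable {S : ℕ}

/-- The coordinates as a disjoint union. -/
def equivSum (S : ℕ) : Coord S ≃ Unit ⊕ Fin S ⊕ Fin S where
  toFun
    | const => .inl ()
    | src g => .inr (.inl g)
    | gate g => .inr (.inr g)
  invFun
    | .inl _ => const
    | .inr (.inl g) => src g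
    | .inr (.inr g) => gate g
  left_inv c := by cases c <;> rfl
  right_inv c := by rcases c with _ | _ | _ <;> rfl

instance : Fintype (Coord S) := Fintype.ofEquiv _ (equivSum S).symm

theorem card_eq (S : ℕ) : Fintype.card (Coord S) = 2 * S + 1 := by
  simp only [Fintype.card_congr (equivSum S), Fintype.card_sum, Fintype.card_unit,
    Fintype.card_fin]
  ring

theorem sum_eq (f : Coord S → ℝ) :
    ∑ c, f c = f const + (∑ g, f (src g) + ∑ g, f (gate g)) := by
  rw [← (equivSum S).symm.sum_comp, Fintype.sum_sum_type, Fintype.sum_sum_type,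
    Fintype.sum_unique]
  rfl

/-- The place of a coordinate in the attention head. -/
noncomputable def index (S : ℕ) : Coord S ≃ Fin (2 * S + 1) :=
  Fintype.equivFinOfCardEq (card_eq S)

end Coord

namespace BoolCircuit

open TransformerLayer

variable {n : ℕ} (C : BoolCircuit n)

/-- The place of a coordinate in the hidden states of the simulation. -/
noncomputable abbrev place : Coord C.size ≃ Fin (1 * (2 * C.size + 1)) :=
  hiddenIndex (Coord.index C.size)

/-- The token embedding: a zero bit marks all `src` coordinates. -/
def tokenEmbedding (M : ℝ) (v : Bool) : Coord C.size → ℝ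
  | .src _ => truthValue M (!v)
  | _ => 0

/-- The position embedding: it sets the constant and marks the `src` coordinates of all gates that
do not read the bit at this position. -/
def positionEmbedding (M : ℝ) (j : Fin n) : Coord C.size → ℝ
  | .const => M
  | .src g => truthValue M (!(C.gate g).readsInput j)
  | .gate _ => 0

/-- The value matrix of the first layer: it complements the `src` coordinates. -/
def inputMatrix : Matrix (Coord C.size) (Coord C.size) ℝ
  | .const, .gate _ => 1
  | .src g', .gate g => if g' = g then -1 else 0
  | _, _ => 0

/-- The output matrix of the first layer: it amplifies the `gate` coordinates by `M`. -/
def amplifyMatrix (M : ℝ) : Matrix (Coord C.size) (Coord C.size) ℝ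
  | .gate g', .gate g => if g' = g then M else 0
  | _, _ => 0

/-- The first feed-forward matrix: it adds up the literals that each gate reads. -/
def literalMatrix : Matrix (Coord C.size) (Coord C.size) ℝ
  | .const, .const => 1
  | .const, .gate g => if (C.gate g).negatesFanin then ((C.fanin g).card : ℝ) else 0
  | .gate j, .gate g =>
    if j ∈ C.fanin g then if (C.gate g).negatesFanin then -1 else 1 else 0
  | _, _ => 0

/-- The second feed-forward matrix: it amplifies by `M`, and complements where necessary, the
disjunctions that compute the gates of depth `l`. -/
def writeMatrix (M : ℝ) (l : ℕ) : Matrix (Coord C.size) (Coord C.size) ℝ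
  | .const, .gate g => if C.gateDepth g = l then truthValue M (C.gate g).negatesOutput else 0
  | .gate g', .gate g =>
    if g' = g then if C.gateDepth g = l then if (C.gate g).negatesOutput then -M else M else 0
    else 0
  | _, _ => 0

/-- The output layer: it compares the token `t` with the value of the output gate. -/
def outputWeight (t : Bool) : Coord C.size → ℝ
  | .const => if t then 0 else 1
  | .src _ => 0
  | .gate g => if g = C.output then if t then 1 else -1 else 0

/-- The layer that copies all input bits to the last position. -/
noncomputable def inputLayer (M : ℝ) : TransformerLayer 1 (2 * C.size + 1) :=
  uniformAttention (Coord.index _) C.inputMatrix (C.amplifyMatrix M)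

/-- The layer that evaluates the gates of depth `l`. -/
noncomputable def gateLayer (M : ℝ) (l : ℕ) : TransformerLayer 1 (2 * C.size + 1) :=
  feedForward (Coord.index _) C.literalMatrix (C.writeMatrix M l)

/-- The Transformer that simulates a circuit of depth at most `D`, in a format with greatest
element `M`. -/
noncomputable def toTransformer (D : ℕ) (M : ℝ) : Transformer n where
  heads := 1
  headDim := 2 * C.size + 1
  numLayers := D + 1
  embed v e := C.tokenEmbedding M v (C.place.symm e)
  pos j e := C.positionEmbedding M j (C.place.symm e)
  layer := Fin.cons (C.inputLayer M) fun l => C.gateLayer M (l + 1)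
  unembed e t := C.outputWeight t (C.place.symm e)

section Parameters

variable {F : Set ℝ} {q : ℕ} {M : ℝ}

theorem inputLayer_paramsIn (hF : HasPrecision F q M) : (C.inputLayer M).ParamsIn F := by
  refine uniformAttention_paramsIn _ hF.zero_mem (fun k c => ?_) fun k c => ?_
  · unfold inputMatrix
    have := hF.neg_mem hF.one_mem
    grind [hF.zero_mem, hF.one_mem]
  · unfold amplifyMatrix
    grind [hF.zero_mem, hF.isGreatest.1]

theorem gateLayer_paramsIn (hF : HasPrecision F q M) (hS : C.size ≤ 2 ^ q) (l : ℕ) :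
    (C.gateLayer M l).ParamsIn F := by
  have hcard (g : Fin C.size) : ((C.fanin g).card : ℝ) ∈ F :=
    hF.natCast_mem ((card_finset_fin_le _).trans hS)
  refine feedForward_paramsIn _ hF.zero_mem (fun k c => ?_) fun k c => ?_
  · unfold literalMatrix
    have := hF.neg_mem hF.one_mem
    grind [hF.zero_mem, hF.one_mem]
  · unfold writeMatrix
    have := hF.neg_mem hF.isGreatest.1
    grind [hF.zero_mem, hF.isGreatest.1, truthValue]

theorem toTransformer_paramsIn (hF : HasPrecision F q M) (hS : C.size ≤ 2 ^ q) (D : ℕ) :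
    (C.toTransformer D M).ParamsIn F := by
  refine ⟨fun v e => ?_, fun j e => ?_, ?_, fun e t => ?_⟩
  · unfold toTransformer tokenEmbedding
    grind [hF.zero_mem, hF.isGreatest.1, truthValue]
  · unfold toTransformer positionEmbedding
    grind [hF.zero_mem, hF.isGreatest.1, truthValue]
  · exact Fin.cases (C.inputLayer_paramsIn hF) fun l => C.gateLayer_paramsIn hF hS (l + 1)
  · unfold toTransformer outputWeight
    have := hF.neg_mem hF.one_mem
    grind [hF.zero_mem, hF.one_mem]

end Parameters

section ForwardPass

variable {F : Set ℝ} {ρ : ℝ → ℝ} {q : ℕ} {M : ℝ} {s : Fin n → Bool}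

/-- The coordinates `y` of a hidden state record the value of the gates of depth at most `l` on
the input `s`. -/
structure Holds (M : ℝ) (s : Fin n → Bool) (l : ℕ) (y : Coord C.size → ℝ) : Prop where
  const : y .const = M
  gate : ∀ g, y (.gate g) = truthValue M (C.valUpTo l s g)

/-- The coordinates `y` of a hidden state hold, before the first layer, the token `v` at the
position `j`. -/
structure IsInitial (M : ℝ) (j : Fin n) (v : Bool) (y : Coord C.size → ℝ) : Prop where
  const : y .const = M
  src : ∀ g, y (.src g) = truthValue M (!((C.gate g).readsInput j && v))
  gate : ∀ g, y (.gate g) = 0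

theorem isInitial_hidden_zero (hρ : IsTruncation F ρ) (hF : HasPrecision F q M) (D : ℕ)
    (s : Fin n → Bool) (j : Fin n) :
    C.IsInitial M j (s j)
      fun c => (C.toTransformer D M).hidden ρ s 0 (Nat.zero_le _) j (C.place c) := by
  constructor
  · simp [Transformer.hidden, toTransformer, tokenEmbedding, positionEmbedding,
      hρ.eq_self hF.isGreatest.1]
  · intro g
    simp [Transformer.hidden, toTransformer, tokenEmbedding, positionEmbedding,
      hρ.truthValue_add hF.isGreatest hF.zero_mem, Bool.or_comm]
  · intro g
    simp [Transformer.hidden, toTransformer, tokenEmbedding, positionEmbedding,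
      hρ.eq_self hF.zero_mem]

variable {C} in
theorem IsInitial.sum_mul_inputMatrix {j : Fin n} {v : Bool} {y : Coord C.size → ℝ}
    (hy : C.IsInitial M j v y) (g : Fin C.size) :
    ∑ c, y c * C.inputMatrix c (.gate g) = truthValue M ((C.gate g).readsInput j && v) := by
  rw [← Bool.not_not ((C.gate g).readsInput j && v), truthValue_not, ← hy.src, ← hy.const]
  simp [Coord.sum_eq, inputMatrix, sub_eq_add_neg]

theorem inputLayer_head_gate (hρ : IsTruncation F ρ) (hF : HasPrecision F q M)
    {X : Fin n → Fin (1 * (2 * C.size + 1)) → ℝ}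
    (hX : ∀ j, C.IsInitial M j (s j) fun c => X j (C.place c)) (i : Fin n) (g : Fin C.size) :
    (C.inputLayer M).head ρ X 0 i (Coord.index _ (.gate g)) =
      ρ (ρ (1 / (i + 1 : ℝ)) *
        ∑ j ∈ Finset.Iic i, truthValue M ((C.gate g).readsInput j && s j)) := by
  rw [inputLayer, uniformAttention_head _ _ (hρ.eq_self hF.zero_mem)]
  simp only [(hX _).sum_mul_inputMatrix,
    hρ.eq_self (truthValue_mem hF.isGreatest.1 hF.zero_mem _)]

theorem inputLayer_forward (hρ : IsTruncation F ρ) (hF : HasPrecision F q M) (hn : n ≤ 2 ^ q)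
    {X : Fin n → Fin (1 * (2 * C.size + 1)) → ℝ}
    (hX : ∀ j, C.IsInitial M j (s j) fun c => X j (C.place c)) {i : Fin n}
    (hi : i.val + 1 = n) :
    C.Holds M s 0 fun c => (C.inputLayer M).forward ρ X i (C.place c) := by
  have hM := hF.isGreatest
  have hforward := uniformAttention_forward (Coord.index C.size) X (hρ.eq_self hF.zero_mem)
    C.inputMatrix (C.amplifyMatrix M) i
  constructor
  · rw [inputLayer, hforward, (hX i).const]
    simp [amplifyMatrix, hρ.eq_self hF.zero_mem, hρ.eq_self hM.1]
  · intro g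
    have hlast : Finset.Iic i = Finset.univ := by
      ext j
      simp only [Finset.mem_Iic, Fin.le_def, Finset.mem_univ, iff_true]
      lia
    have hsum : ∑ k, (C.inputLayer M).head ρ X 0 i (Coord.index _ k) *
          C.amplifyMatrix M k (.gate g) =
        (C.inputLayer M).head ρ X 0 i (Coord.index _ (.gate g)) * M := by
      simp [Coord.sum_eq, amplifyMatrix]
    rw [inputLayer, hforward, ← inputLayer, (hX i).gate, add_zero, hsum,
      C.inputLayer_head_gate hρ hF hX,
      hρ.mul_sum_truthValue_mul hM hF.zero_mem hF.one_mem
        (hρ.le_of_ge hF.zero_mem (by positivity)) (hF.one_le_truncation_mul hρ (hi.trans_le hn)),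
      hρ.eq_self (truthValue_mem hM.1 hF.zero_mem _),
      hρ.eq_self (truthValue_mem hM.1 hF.zero_mem _), C.valUpTo_zero, hlast]
    simp only [Finset.mem_univ, true_and]

variable {C} in
theorem Holds.sum_mul_literalMatrix {l : ℕ} {y : Coord C.size → ℝ} (hy : C.Holds M s l y)
    {g : Fin C.size} (hg : C.gateDepth g = l + 1) :
    ∑ c, y c * C.literalMatrix c (.gate g) =
      ∑ j ∈ C.fanin g, truthValue M (C.val s j ^^ (C.gate g).negatesFanin) := by
  have hgate : ∀ j ∈ C.fanin g, y (.gate j) = truthValue M (C.val s j) := fun j hj => by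
    have := C.gateDepth_lt_of_mem_fanin hj
    rw [hy.gate, C.valUpTo_of_le (by lia)]
  cases hneg : (C.gate g).negatesFanin <;>
    simp [Coord.sum_eq, literalMatrix, hneg, hy.const, truthValue_not, mul_ite,
      Finset.sum_ite_mem, Finset.sum_congr rfl hgate, mul_comm M,
      ← sub_eq_add_neg]

variable {C} in
theorem Holds.feedForward_gate (hρ : IsTruncation F ρ) (hF : HasPrecision F q M) (hq : 1 ≤ q)
    {l : ℕ} {y : Coord C.size → ℝ} (hy : C.Holds M s l y) (g : Fin C.size) :
    ρ (∑ k, ρ (gelu (ρ (∑ c, y c * C.literalMatrix c k))) * C.writeMatrix M (l + 1) k (.gate g)) =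
      truthValue M (decide (C.gateDepth g = l + 1) && C.val s g) := by
  have hM := hF.isGreatest
  by_cases hg : C.gateDepth g = l + 1
  · have hM2 : 2 ≤ M := by
      exact_mod_cast hM.2 (hF.natCast_mem (le_self_pow₀ one_le_two (by lia)))
    have hconst : ∑ c, y c * C.literalMatrix c .const = M := by
      simp [Coord.sum_eq, literalMatrix, hy.const]
    have hdisjunction := hρ.sum_truthValue hM hF.zero_mem (t := C.fanin g)
      (v := fun j => C.val s j ^^ (C.gate g).negatesFanin)
    rw [← hy.sum_mul_literalMatrix hg] at hdisjunction
    rw [decide_eq_true hg, Bool.true_and, C.val_eq_negatesOutput_xor (by lia),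
      ← hρ.gelu_truthValue_xor hM hF.zero_mem hF.one_mem hM2, Coord.sum_eq, hconst,
      hρ.eq_self hM.1, ← hdisjunction]
    simp [writeMatrix, hg]
  · rw [decide_eq_false hg, Bool.false_and, truthValue_false]
    simp [Coord.sum_eq, writeMatrix, hg, hρ.eq_self hF.zero_mem]

theorem gateLayer_forward (hρ : IsTruncation F ρ) (hF : HasPrecision F q M) (hq : 1 ≤ q)
    {X : Fin n → Fin (1 * (2 * C.size + 1)) → ℝ} {i : Fin n} (hXF : ∀ e, X i e ∈ F) {l : ℕ}
    (hX : C.Holds M s l fun c => X i (C.place c)) :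
    C.Holds M s (l + 1) fun c => (C.gateLayer M (l + 1)).forward ρ X i (C.place c) := by
  have hzero := hρ.eq_self hF.zero_mem
  have hforward := feedForward_forward (Coord.index C.size) X hzero C.literalMatrix
    (C.writeMatrix M (l + 1)) i fun e => hρ.eq_self (hXF e)
  constructor
  · rw [gateLayer, hforward, hX.const]
    simp [writeMatrix, hzero, hρ.eq_self hF.isGreatest.1]
  · intro g
    rw [gateLayer, hforward, hX.gate, hX.feedForward_gate hρ hF hq,
      hρ.truthValue_add hF.isGreatest hF.zero_mem, C.valUpTo_succ]

theorem holds_hidden (hρ : IsTruncation F ρ) (hF : HasPrecision F q M) (hq : 1 ≤ q)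
    (hn : n ≤ 2 ^ q) (D : ℕ) (s : Fin n → Bool) {i : Fin n} (hi : i.val + 1 = n) :
    ∀ (l : ℕ) (hl : l + 1 ≤ (C.toTransformer D M).numLayers),
      C.Holds M s l fun c => (C.toTransformer D M).hidden ρ s (l + 1) hl i (C.place c)
  | 0, _ => C.inputLayer_forward hρ hF hn (C.isInitial_hidden_zero hρ hF D s) hi
  | l + 1, hl => C.gateLayer_forward hρ hF hq
      (Transformer.hidden_mem hρ.mem (C.toTransformer D M) s _ i)
      (holds_hidden hρ hF hq hn D s hi l (by lia))

variable {C} in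
theorem Holds.sum_mul_outputWeight {l : ℕ} {y : Coord C.size → ℝ} (hy : C.Holds M s l y)
    (hl : C.depth ≤ l) (t : Bool) :
    ∑ c, y c * C.outputWeight t c = truthValue M (t == C.eval s) := by
  have hout : C.valUpTo l s C.output = C.eval s := C.valUpTo_of_le hl
  cases t <;> simp [Coord.sum_eq, outputWeight, hy.const, hy.gate, hout, truthValue_not,
    sub_eq_add_neg]

theorem logit_toTransformer (hρ : IsTruncation F ρ) (hF : HasPrecision F q M) (hq : 1 ≤ q)
    (hn : n ≤ 2 ^ q) {D : ℕ} (hD : C.depth ≤ D) (s : Fin n → Bool) {i : Fin n}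
    (hi : i.val + 1 = n) (t : Bool) :
    (C.toTransformer D M).logit ρ s i t = truthValue M (t == C.eval s) := by
  have hsum := (C.holds_hidden hρ hF hq hn D s hi D le_rfl).sum_mul_outputWeight hD t
  rw [← hρ.eq_self (truthValue_mem hF.isGreatest.1 hF.zero_mem (t == C.eval s)), ← hsum,
    Transformer.logit]
  congr 1
  refine (C.place.sum_comp _).symm.trans (Finset.sum_congr rfl fun c _ => ?_)
  simp only [toTransformer, Equiv.symm_apply_apply]

end ForwardPass

theorem toTransformer_generates {F : Set ℝ} {ρ : ℝ → ℝ} {q : ℕ} {M : ℝ}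
    (hρ : IsTruncation F ρ) (hF : HasPrecision F q M) (hq : 2 ≤ q) (hn : n ≤ 2 ^ q) {D : ℕ}
    (hD : C.depth ≤ D) (s : Fin n → Bool) :
    (C.toTransformer D M).Generates ρ s (C.eval s) := by
  intro i hi t ht
  have hlogit := C.logit_toTransformer hρ hF (by lia) hn hD s hi
  have hsum : ∑ t', Real.exp (truthValue M (t' == C.eval s)) = Real.exp M + 1 := by
    cases C.eval s <;> simp [truthValue, add_comm]
  have hM : 3 ≤ M := by
    exact_mod_cast hF.isGreatest.2 (hF.natCast_mem (k := 3) (by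
      calc 3 ≤ 2 ^ 2 := by norm_num
        _ ≤ 2 ^ q := Nat.pow_le_pow_right two_pos hq))
  have hexp : 3 ≤ Real.exp M := by linarith [Real.add_one_le_exp M]
  simp only [Transformer.nextProb, hlogit, hsum]
  rw [beq_false_of_ne ht, beq_self_eq_true, truthValue_true, truthValue_false, Real.exp_zero]
  calc ρ (1 / (Real.exp M + 1)) ≤ ((2 : ℝ) ^ 2)⁻¹ := by
        refine hρ.le_of_le (hF.inv_two_pow_mem hq) ?_
        rw [one_div]
        gcongr
        linarith
    _ < ((2 : ℝ) ^ 1)⁻¹ := by norm_num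
    _ ≤ ρ (Real.exp M / (Real.exp M + 1)) := by
        refine hρ.le_of_ge (hF.inv_two_pow_mem (by lia)) ?_
        rw [pow_one, inv_eq_one_div, div_le_div_iff₀ two_pos (by positivity)]
        linarith

end BoolCircuit

theorem PolyBounded.size_toTransformer {C : (n : ℕ) → BoolCircuit n}
    (hC : PolyBounded fun n => (C n).size) (D : ℕ) (M : ℕ → ℝ) :
    PolyBounded fun n => ((C n).toTransformer D (M n)).size := by
  have hd : PolyBounded fun n => 2 * (C n).size + 1 := ((const 2).mul hC).add (const 1)
  have hd2 := hd.mul hd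
  have hlayer := (((const 4).mul hd2).add ((const 2).mul hd2)).add hd
  have hembed := ((const 2).mul hd).add (PolyBounded.id.mul hd)
  simp only [Transformer.size, Transformer.dim, BoolCircuit.toTransformer, one_mul, sq]
  exact (hembed.add ((const (D + 1)).mul hlayer)).add ((const 2).mul hd)

theorem FormatKind.logBounded_bits (κ : FormatKind) {q : ℕ → ℕ} (hq : LogBounded q) :
    LogBounded fun n => κ.bits (q n + 1) (q n + 1) :=
  ((hq.add hq).add (.const 4)).mono fun n => (κ.bits_le _ _).trans (by lia)

theorem mainTheorem3_general (κ : FormatKind) (C : (n : ℕ) → BoolCircuit n)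
    (hC : IsAC0Family C) :
    ∃ (a b : ℕ → ℕ) (T : (n : ℕ) → Transformer n),
      LogBounded (fun n => κ.bits (a n) (b n)) ∧
      PolyBounded (fun n => (T n).size) ∧
      (∃ L : ℕ, ∀ n, (T n).numLayers ≤ L) ∧
      (∀ n, (T n).ParamsIn (κ.values (a n) (b n))) ∧
      ∀ n, ∀ ρ : ℝ → ℝ, IsTruncation (κ.values (a n) (b n)) ρ →
        ∀ s : Fin n → Bool, (T n).Generates ρ s ((C n).eval s) := by
  obtain ⟨hsize, D, hD⟩ := hC
  let q (n : ℕ) : ℕ := Nat.log 2 (n + (C n).size) + 2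
  have hlog : LogBounded q := (PolyBounded.id.add hsize).logBounded_log.add (.const 2)
  have hpow (n : ℕ) : n + (C n).size ≤ 2 ^ q n :=
    (Nat.lt_pow_of_log_lt one_lt_two (by lia)).le
  choose M hM using fun n => κ.exists_hasPrecision (q n)
  refine ⟨fun n => q n + 1, fun n => q n + 1, fun n => (C n).toTransformer D (M n),
    κ.logBounded_bits hlog, hsize.size_toTransformer D M, ⟨D + 1, fun _ => le_rfl⟩,
    fun n => (C n).toTransformer_paramsIn (hM n) ?_ D,
    fun n ρ hρ s => (C n).toTransformer_generates hρ (hM n) ?_ ?_ (hD n) s⟩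
  · exact (Nat.le_add_left _ _).trans (hpow n)
  · exact Nat.le_add_left 2 _
  · exact (Nat.le_add_right _ _).trans (hpow n)

theorem mainTheorem3 (κ : FormatKind) (r : RoundingMode)
    (C : (n : ℕ) → BoolCircuit n) (hC : IsAC0Family C) :
    ∃ (a b : ℕ → ℕ) (T : (n : ℕ) → Transformer n),
      LogBounded (fun n => κ.bits (a n) (b n)) ∧
      PolyBounded (fun n => (T n).size) ∧
      (∃ L : ℕ, ∀ n, (T n).numLayers ≤ L) ∧
      (∀ n, (T n).ParamsIn (κ.values (a n) (b n))) ∧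
      ∀ n, 1 ≤ n → ∀ ρ : ℝ → ℝ, r.IsRounding (κ.values (a n) (b n)) ρ →
        ∀ s : Fin n → Bool, (T n).Generates ρ s ((C n).eval s) := by
  obtain ⟨a, b, T, hbits, hsize, hlayers, hparams, hgen⟩ := mainTheorem3_general κ C hC
  exact ⟨a, b, T, hbits, hsize, hlayers, hparams, fun n _ ρ hρ => hgen n ρ hρ.isTruncation⟩
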